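/- Consider a free-space optical network in which a source $S$ sends to a destination $D$ through $N$ decode-and-forward relays $R_1,\dots,R_N$, without a direct link. Each link $AB\in\{SR_m,R_mD : 1\le m\le N\}$ has a fixed path loss coefficient $\bar h_{AB}>0$, a fixed fraction $\rho_{AB}>0$ of the total optical power, and channel gain $h_{AB}=\bar h_{AB}\tilde h_{AB}$, where the $2N$ fading variables $\tilde h_{AB}$ are independent and $\tilde h_{AB}$ has the Gamma-Gamma density $$f(x)=\frac{2(\alpha_{AB}\beta_{AB})^{\frac{\alpha_{AB}+\beta_{AB}}2}}{\Gamma(\alpha_{AB})\Gamma(\beta_{AB})}\,x^{\frac{\alpha_{AB}+\beta_{AB}}2-1}K_{\alpha_{AB}-\beta_{AB}}\bigl(2\sqrt{\alpha_{AB}\beta_{AB}x}\bigr),\qquad x>0,$$ with fixed $\alpha_{AB},\beta_{AB}>0$ such that $\alpha_{AB}-\beta_{AB}\notin\mathbb Z$; $K_\nu$ is the modified Bessel function of the second kind. Put $p_{AB}=\max(\alpha_{AB},\beta_{AB})$ and $q_{AB}=\min(\alpha_{AB},\beta_{AB})$. Let $\eta,T_b,P_t,N_0,\gamma_{th}>0$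 be the responsivity, slot duration, total optical power, noise level and threshold SNR, and let $P_M=\eta T_bP_t/\sqrt{N_0\gamma_{th}}$ be the power margin. A received signal of weighted gain $g$ has SNR $\eta^2T_b^2P_t^2g^2/N_0$, where $g=\rho_{SR_m}h_{SR_m}$ at relay $R_m$ and $g=\sum_{m\in\mathbf D}\rho_{R_mD}h_{R_mD}$ at the destination; the decoding set $\mathbf D\subseteq\{1,\dots,N\}$ consists of the relays whose SNR exceeds $\gamma_{th}$. In the all-active protocol all relays in $\mathbf D$ transmit, and an outage occurs if $\mathbf D=\emptyset$ or the SNR at the destination is below $\gamma_{th}$; let $P_{out}$ be its probability. For $S\subseteq\{1,\dots,N\}$ put $$T_S(P_M)=\prod_{m\notin S}\left(\frac{\Gamma(p_{SR_m}-q_{SR_m})}{\Gamma(\alpha_{SR_m})\Gamma(\beta_{SR_m})}\,\frac{\Bigl(\frac{\alpha_{SR_m}\beta_{SR_m}}{\bar h_{SR_m}\rho_{SR_m}}\Bigr)^{q_{SR_m}}}{q_{SR_m}}\right)\cdot\frac{\prod_{m\in S}\Bigl(\frac{\alpha_{R_mD}\beta_{R_mD}}{\bar h_{R_mD}\rho_{R_mD}}\Bigr)^{q_{R_mD}}\frac{\Gamma(q_{R_mD})\Gamma(p_{R_mD}-q_{R_mD})}{\Gamma(\alpha_{R_mD})\Gamma(\beta_{R_mD})}}{\Gamma\bigl(1+\sum_{m\in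 S}q_{R_mD}\bigr)}\cdot\Bigl(\frac1{P_M}\Bigr)^{\sum_{m\notin S}q_{SR_m}+\sum_{m\in S}q_{R_mD}}.$$ Then, as $P_M\to\infty$ (in whatever way $\eta,T_b,P_t,N_0,\gamma_{th}$ vary), $$P_{out}\sim\sum_{S\subseteq\{1,\dots,N\}}T_S(P_M),$$ that is, the ratio of the two sides tends to $1$. Moreover each summand is the leading-order term of the contribution of its decoding set: for every $S$, $\Pr\{\mathbf D=S\text{ and an outage occurs}\}\sim T_S(P_M)$. -/

import Mathlib

open MeasureTheory ProbabilityTheory Filter Asymptotics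

noncomputable section

namespace FSO

/-- The modified Bessel function of the second kind `K_ν(z)`, for real order `ν` and argument
`z > 0`, through its integral representation
`K_ν(z) = (1/2) (z/2)^ν ∫_0^∞ exp (-t - z² / (4 t)) t^(-ν-1) dt`. -/
def besselK (ν z : ℝ) : ℝ :=
  (1 / 2) * (z / 2) ^ ν *
    ∫ t in Set.Ioi (0 : ℝ), Real.exp (-t - z ^ 2 / (4 * t)) * t ^ (-ν - 1)

/-- The Gamma-Gamma probability density function with parameters `α, β`. -/
def gammaGammaPDFReal (α β x : ℝ) : ℝ :=
  if 0 < x then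
    2 * (α * β) ^ ((α + β) / 2) / (Real.Gamma α * Real.Gamma β) * x ^ ((α + β) / 2 - 1) *
      besselK (α - β) (2 * √(α * β * x))
  else 0

/-- The Gamma-Gamma distribution on `ℝ` with parameters `α, β`. -/
def gammaGammaMeasure (α β : ℝ) : Measure ℝ :=
  volume.withDensity fun x => ENNReal.ofReal (gammaGammaPDFReal α β x)

/-- The deterministic parameters of one free-space optical link: the Gamma-Gamma parameters
`α, β`, the path loss coefficient `hbar`, and the fraction `ρ` of the total optical power that is
allocated to the link. -/
structure Link where
  α : ℝ
  β : ℝ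
  hbar : ℝ
  ρ : ℝ
  α_pos : 0 < α
  β_pos : 0 < β
  hbar_pos : 0 < hbar
  ρ_pos : 0 < ρ

/-- The larger one of the two Gamma-Gamma parameters. -/
def Link.p (L : Link) : ℝ := max L.α L.β

/-- The smaller one of the two Gamma-Gamma parameters. -/
def Link.q (L : Link) : ℝ := min L.α L.β

/-- The parameters common to all links: responsivity `η`, slot duration `Tb`, total transmitted
optical power `Pt`, noise level `N0`, and threshold SNR `γth`. -/
structure OperatingPoint where
  η : ℝ
  Tb : ℝ
  Pt : ℝ
  N0 : ℝ
  γth : ℝ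
  η_pos : 0 < η
  Tb_pos : 0 < Tb
  Pt_pos : 0 < Pt
  N0_pos : 0 < N0
  γth_pos : 0 < γth

/-- The power margin `P_M = η T_b P_t / √(N₀ γ_th)`. -/
def OperatingPoint.powerMargin (o : OperatingPoint) : ℝ :=
  o.η * o.Tb * o.Pt / √(o.N0 * o.γth)

/-- The instantaneous SNR `η² T_b² P_t² g² / N₀` of a received signal with overall weighted
channel gain `g`. For a single link `g = ρ h`; for simultaneously transmitting relays, `g` is the
sum of the weighted gains, since the received optical signals add up. -/
def OperatingPoint.snr (o : OperatingPoint) (g : ℝ) : ℝ :=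
  o.η ^ 2 * o.Tb ^ 2 * o.Pt ^ 2 * g ^ 2 / o.N0

/-- The weighted channel gain `ρ h` of a link, where `h = hbar * x` and `x` is the value of the
turbulence-induced fading. -/
def Link.weightedGain (L : Link) (x : ℝ) : ℝ := L.ρ * (L.hbar * x)

open Classical in
/-- The decoding set: the relays whose source-relay SNR exceeds the threshold, when the fading
values of the source-relay links are `x`. -/
def decodingSet {N : ℕ} (SR : Fin N → Link) (o : OperatingPoint) (x : Fin N → ℝ) :
    Finset (Fin N) :=
  {m | o.γth < o.snr ((SR m).weightedGain (x m))}

/-- The outage event of the all-active protocol, when the fading values of the source-relay and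
relay-destination links are `x` and `y`: the decoding set is empty, or the SNR of the link
between the decoding relays and the destination is below the threshold. -/
def AllActiveOutage {N : ℕ} (SR RD : Fin N → Link) (o : OperatingPoint) (x y : Fin N → ℝ) :
    Prop :=
  decodingSet SR o x = ∅ ∨
    o.snr (∑ m ∈ decodingSet SR o x, (RD m).weightedGain (y m)) < o.γth

/-- The leading-order summand that belongs to the decoding set `S`, at power margin `PM`. The
denominator `Γ(1 + ∑ q)` is `(∑ q) Γ(∑ q)` for nonempty `S`, and `1` for empty `S`. -/
def asympTerm {N : ℕ} (SR RD : Fin N → Link) (S : Finset (Fin N)) (PM : ℝ) : ℝ :=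
  (∏ m ∈ Sᶜ,
      Real.Gamma ((SR m).p - (SR m).q) / (Real.Gamma (SR m).α * Real.Gamma (SR m).β) *
        (((SR m).α * (SR m).β / ((SR m).hbar * (SR m).ρ)) ^ (SR m).q / (SR m).q)) *
    ((∏ m ∈ S,
      ((RD m).α * (RD m).β / ((RD m).hbar * (RD m).ρ)) ^ (RD m).q *
        (Real.Gamma (RD m).q * Real.Gamma ((RD m).p - (RD m).q) /
          (Real.Gamma (RD m).α * Real.Gamma (RD m).β))) /
      Real.Gamma (1 + ∑ m ∈ S, (RD m).q)) *
    (1 / PM) ^ ((∑ m ∈ Sᶜ, (SR m).q) + ∑ m ∈ S, (RD m).q)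

end FSO

end

open scoped Topology

/-! Put `r = 1 / P_M`. Since the SNR of a gain `g` is `γth * (P_M * |g|) ^ 2`, both threshold tests
compare `|g|` with `r`. The event "`D = S` and outage" says that the source-relay gains exceed `r`
exactly on `S` and that the weighted relay-destination sum over `S` is below `r`. Independence
factors its probability: the factors for `S` tend to 1, those for `Sᶜ` are lower tails of single
gains, and the last factor is the lower tail of a sum.

These tails depend only on the densities near 0. The Bessel integral shows that a Gamma-Gamma
density is `x ^ (q - 1)` times a bounded factor with a positive limit at 0
(`Link.isPowerLawDensity`). Convolving power laws produces Beta integrals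
(`IsPowerLawDensity.tendsto_convolution`), and induction turns them into the Gamma quotient of
`tendsto_measureReal_sum_lt`. The outage event is the finite disjoint union over `S`, and all
leading terms are positive, so the equivalences add up. -/

/-- A density on `(0, ∞)` that is bounded by a multiple of `x ^ (q - 1)` and behaves like
`c * x ^ (q - 1)` at the origin. -/
structure IsPowerLawDensity (f : ℝ → ℝ) (q c : ℝ) : Prop where
  exponent_pos : 0 < q
  measurable : Measurable f
  nonneg : ∀ x, 0 ≤ f x
  eq_zero : ∀ x ≤ 0, f x = 0
  bound : ∃ C, ∀ x, 0 < x → f x ≤ C * x ^ (q - 1)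
  tendsto : Tendsto (fun x => f x / x ^ (q - 1)) (𝓝[>] 0) (𝓝 c)

/-! ### The damped Gamma integral behind the Bessel function. -/

/-- The Gamma integral with an additional damping factor `exp (-b / t)`. -/
noncomputable def dampedGamma (s b : ℝ) : ℝ :=
  ∫ t in Set.Ioi (0 : ℝ), Real.exp (-t - b / t) * t ^ (s - 1)

/-- Substitute `t ↦ b / t`, carried out as an inversion followed by a scaling. This is the symmetry
`K_ν = K_{-ν}`, which lets either `α` or `β` be taken as the leading exponent. -/
lemma dampedGamma_neg (s : ℝ) {b : ℝ} (hb : 0 < b) :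
    dampedGamma (-s) b = b ^ (-s) * dampedGamma s b := by
  have h1 := integral_comp_rpow_Ioi (fun t => Real.exp (-t - b / t) * t ^ (-s - 1))
    (p := -1) (by norm_num)
  have h2 := integral_comp_mul_left_Ioi'
    (fun y : ℝ => (|(-1 : ℝ)| * y ^ ((-1 : ℝ) - 1)) •
      (Real.exp (-(y ^ (-1 : ℝ)) - b / y ^ (-1 : ℝ)) * (y ^ (-1 : ℝ)) ^ (-s - 1))) 0
    (inv_pos.mpr hb)
  rw [mul_zero, h1] at h2
  rw [dampedGamma, dampedGamma, ← h2, smul_eq_mul, ← integral_const_mul, ← integral_const_mul]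
  refine setIntegral_congr_fun measurableSet_Ioi fun x (hx : 0 < x) => ?_
  have hy : 0 < b⁻¹ * x := by positivity
  simp only [smul_eq_mul, abs_neg, abs_one, one_mul, Real.rpow_neg_one]
  rw [Real.inv_rpow hy.le, ← Real.rpow_neg hy.le]
  have e1 : -(b⁻¹ * x)⁻¹ - b / (b⁻¹ * x)⁻¹ = -x - b / x := by
    field_simp
    ring
  rw [e1]
  have e2 : b⁻¹ * (b⁻¹ * x) ^ ((-1 : ℝ) - 1) * (b⁻¹ * x) ^ (-(-s - 1)) =
      b ^ (-s) * x ^ (s - 1) := by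
    rw [mul_assoc, ← Real.rpow_add hy, show (-1 : ℝ) - 1 + -(-s - 1) = s - 1 by ring,
      Real.mul_rpow (by positivity) hx.le, Real.inv_rpow hb.le, ← Real.rpow_neg hb.le,
      ← Real.rpow_neg_one, ← mul_assoc, ← Real.rpow_add hb]
    congr 2
    ring
  linear_combination Real.exp (-x - b / x) * e2

lemma dampedGamma_nonneg (s b : ℝ) : 0 ≤ dampedGamma s b :=
  setIntegral_nonneg measurableSet_Ioi fun t (ht : 0 < t) => by positivity

lemma dampedGamma_integrand_le (s : ℝ) {b t : ℝ} (hb : 0 ≤ b) (ht : 0 < t) :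
    Real.exp (-t - b / t) * t ^ (s - 1) ≤ Real.exp (-t) * t ^ (s - 1) := by
  have : 0 ≤ b / t := by positivity
  gcongr
  linarith

lemma dampedGamma_le {s b : ℝ} (hs : 0 < s) (hb : 0 ≤ b) : dampedGamma s b ≤ Real.Gamma s := by
  rw [Real.Gamma_eq_integral hs]
  refine integral_mono_of_nonneg ?_ (Real.GammaIntegral_convergent hs) ?_ <;>
    filter_upwards [ae_restrict_mem measurableSet_Ioi] with t (ht : 0 < t)
  · simp only [Pi.zero_apply]
    positivity
  · exact dampedGamma_integrand_le s hb ht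

lemma tendsto_dampedGamma {s : ℝ} (hs : 0 < s) :
    Tendsto (dampedGamma s) (𝓝[>] 0) (𝓝 (Real.Gamma s)) := by
  rw [Real.Gamma_eq_integral hs]
  refine tendsto_integral_filter_of_dominated_convergence
    (fun t => Real.exp (-t) * t ^ (s - 1)) (.of_forall fun b => by fun_prop) ?_
    (Real.GammaIntegral_convergent hs) ?_
  · filter_upwards [self_mem_nhdsWithin] with b (hb : 0 < b)
    filter_upwards [ae_restrict_mem measurableSet_Ioi] with t (ht : 0 < t)
    rw [Real.norm_of_nonneg (by positivity)]
    exact dampedGamma_integrand_le s hb.le ht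
  · filter_upwards with t
    refine tendsto_nhdsWithin_of_tendsto_nhds ?_
    have : Continuous fun b : ℝ => Real.exp (-t - b / t) * t ^ (s - 1) := by fun_prop
    simpa using this.tendsto 0

lemma measurable_dampedGamma (s : ℝ) : Measurable (dampedGamma s) := by
  refine (StronglyMeasurable.integral_prod_right
    (f := fun b t : ℝ => Real.exp (-t - b / t) * t ^ (s - 1)) ?_).measurable
  exact Measurable.stronglyMeasurable (by fun_prop)

/-! ### The Gamma-Gamma density near the origin. -/

namespace FSO

lemma gammaGammaPDFReal_eq_left {α β x : ℝ} (hα : 0 < α) (hβ : 0 < β) (hx : 0 < x) :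
    gammaGammaPDFReal α β x = (α * β) ^ α / (Real.Gamma α * Real.Gamma β) * x ^ (α - 1) *
      dampedGamma (β - α) (α * β * x) := by
  have hb : 0 < α * β * x := by positivity
  have hsq : (2 * √(α * β * x)) ^ 2 = 4 * (α * β * x) := by
    rw [mul_pow, Real.sq_sqrt hb.le]
    ring
  have hJ : ∫ t in Set.Ioi (0 : ℝ),
      Real.exp (-t - (2 * √(α * β * x)) ^ 2 / (4 * t)) * t ^ (-(α - β) - 1) =
        dampedGamma (β - α) (α * β * x) := by
    rw [dampedGamma, hsq, neg_sub]
    simp_rw [mul_div_mul_left _ _ (four_ne_zero' ℝ)]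
  have hpow : (α * β) ^ ((α + β) / 2) * x ^ ((α + β) / 2 - 1) * (√(α * β * x)) ^ (α - β) =
      (α * β) ^ α * x ^ (α - 1) := by
    rw [Real.sqrt_eq_rpow, ← Real.rpow_mul hb.le, Real.mul_rpow (by positivity) hx.le,
      mul_mul_mul_comm, ← Real.rpow_add (by positivity), ← Real.rpow_add hx]
    congr 2 <;> ring
  rw [gammaGammaPDFReal, if_pos hx, besselK, hJ, mul_div_cancel_left₀ _ two_ne_zero]
  linear_combination dampedGamma (β - α) (α * β * x) / (Real.Gamma α * Real.Gamma β) * hpow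

lemma gammaGammaPDFReal_eq_right {α β x : ℝ} (hα : 0 < α) (hβ : 0 < β) (hx : 0 < x) :
    gammaGammaPDFReal α β x = (α * β) ^ β / (Real.Gamma α * Real.Gamma β) * x ^ (β - 1) *
      dampedGamma (α - β) (α * β * x) := by
  rw [gammaGammaPDFReal_eq_left hα hβ hx, ← neg_sub α β, dampedGamma_neg _ (by positivity),
    Real.mul_rpow (by positivity) hx.le]
  have h1 : (α * β) ^ α * (α * β) ^ (-(α - β)) = (α * β) ^ β := by
    rw [← Real.rpow_add (by positivity)]
    congr 1
    ring
  have h2 : x ^ (α - 1) * x ^ (-(α - β)) = x ^ (β - 1) := by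
    rw [← Real.rpow_add hx]
    congr 1
    ring
  rw [← h1, ← h2]
  ring

lemma Link.q_pos (L : Link) : 0 < L.q := lt_min L.α_pos L.β_pos

/-- The coefficient of `x ^ (q - 1)` in the Gamma-Gamma density of a link at the origin. -/
noncomputable def Link.leadingCoeff (L : Link) : ℝ :=
  (L.α * L.β) ^ L.q / (Real.Gamma L.α * Real.Gamma L.β) * Real.Gamma (L.p - L.q)

/-- Of the two forms of the density, this picks the one whose damped integral has the nonnegative
index `p - q`. When `α ≠ β` the index is positive, so the integral stays bounded and tends to `Γ(p -
q)` as `x → 0`. -/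
lemma Link.gammaGammaPDFReal_eq (L : Link) {x : ℝ} (hx : 0 < x) :
    gammaGammaPDFReal L.α L.β x =
      (L.α * L.β) ^ L.q / (Real.Gamma L.α * Real.Gamma L.β) * x ^ (L.q - 1) *
        dampedGamma (L.p - L.q) (L.α * L.β * x) := by
  rcases le_total L.α L.β with h | h
  · rw [Link.p, Link.q, max_eq_right h, min_eq_left h, gammaGammaPDFReal_eq_left L.α_pos L.β_pos hx]
  · rw [Link.p, Link.q, max_eq_left h, min_eq_right h,
      gammaGammaPDFReal_eq_right L.α_pos L.β_pos hx]

lemma Link.q_lt_p {L : Link} (h : L.α ≠ L.β) : L.q < L.p := min_lt_max.mpr h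

lemma Link.leadingCoeff_pos {L : Link} (h : L.α ≠ L.β) : 0 < L.leadingCoeff := by
  have := L.α_pos
  have := L.β_pos
  have := Real.Gamma_pos_of_pos L.α_pos
  have := Real.Gamma_pos_of_pos L.β_pos
  have := Real.Gamma_pos_of_pos (sub_pos.mpr (Link.q_lt_p h))
  rw [Link.leadingCoeff]
  positivity

lemma Link.isPowerLawDensity {L : Link} (h : L.α ≠ L.β) :
    IsPowerLawDensity (gammaGammaPDFReal L.α L.β) L.q L.leadingCoeff := by
  have hα := L.α_pos
  have hβ := L.β_pos
  have hΓα := Real.Gamma_pos_of_pos hα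
  have hΓβ := Real.Gamma_pos_of_pos hβ
  have hs : 0 < L.p - L.q := sub_pos.mpr (Link.q_lt_p h)
  have hzero : ∀ x ≤ 0, gammaGammaPDFReal L.α L.β x = 0 := fun x hx =>
    if_neg hx.not_gt
  refine ⟨L.q_pos, ?_, fun x => ?_, hzero, ⟨L.leadingCoeff, fun x hx => ?_⟩, ?_⟩
  · have : gammaGammaPDFReal L.α L.β = fun x => if 0 < x then
        (L.α * L.β) ^ L.q / (Real.Gamma L.α * Real.Gamma L.β) * x ^ (L.q - 1) *
          dampedGamma (L.p - L.q) (L.α * L.β * x) else 0 := by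
      ext x
      split_ifs with hx
      · exact L.gammaGammaPDFReal_eq hx
      · exact hzero x (not_lt.mp hx)
    rw [this]
    have := measurable_dampedGamma (L.p - L.q)
    exact Measurable.ite measurableSet_Ioi (by fun_prop) measurable_const
  · rcases le_or_gt x 0 with hx | hx
    · exact (hzero x hx).ge
    · rw [L.gammaGammaPDFReal_eq hx]
      have := dampedGamma_nonneg (L.p - L.q) (L.α * L.β * x)
      positivity
  · rw [L.gammaGammaPDFReal_eq hx, Link.leadingCoeff, mul_right_comm]
    gcongr
    exact dampedGamma_le hs (by positivity)
  · have hlin : Tendsto (fun x : ℝ => L.α * L.β * x) (𝓝[>] 0) (𝓝[>] 0) := by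
      refine tendsto_nhdsWithin_iff.mpr ⟨?_, ?_⟩
      · have : Continuous fun x : ℝ => L.α * L.β * x := by fun_prop
        simpa using (this.tendsto 0).mono_left nhdsWithin_le_nhds
      · filter_upwards [self_mem_nhdsWithin] with x (hx : 0 < x)
        exact Set.mem_Ioi.mpr (by positivity)
    refine (((tendsto_dampedGamma hs).comp hlin).const_mul
      ((L.α * L.β) ^ L.q / (Real.Gamma L.α * Real.Gamma L.β))).congr' ?_
    filter_upwards [self_mem_nhdsWithin] with x (hx : 0 < x)
    have := Real.rpow_pos_of_pos hx (L.q - 1)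
    rw [L.gammaGammaPDFReal_eq hx, Function.comp_apply]
    field_simp

end FSO

/-! ### Convolution of power laws and lower tails of sums. -/

lemma measurable_cdf_lt {Ω : Type*} [MeasurableSpace Ω] (μ : Measure Ω) [IsFiniteMeasure μ]
    (Z : Ω → ℝ) : Measurable fun s => μ.real {ω | Z ω < s} := by
  refine Monotone.measurable fun s t hst => measureReal_mono fun ω (hω : Z ω < s) => ?_
  exact lt_of_lt_of_le hω hst

/-- Fubini for the joint law, sliced at a fixed value of `X`. Only `X` needs a density: `Z` may be
the empty sum, from which the induction on the number of summands starts. -/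
lemma measureReal_add_mul_lt {Ω : Type*} [MeasurableSpace Ω] {μ : Measure Ω}
    [IsProbabilityMeasure μ] {Z X : Ω → ℝ} {f : ℝ → ℝ} (hf : Measurable f) (hf0 : ∀ x, 0 ≤ f x)
    (hZ : AEMeasurable Z μ)
    (hX : HasLaw X (volume.withDensity fun x => ENNReal.ofReal (f x)) μ)
    (hZX : IndepFun Z X μ) (w r : ℝ) :
    μ.real {ω | Z ω + w * X ω < r} = ∫ y, μ.real {ω | Z ω < r - w * y} * f y := by
  have hZ' : HasLaw Z (μ.map Z) μ := ⟨hZ, rfl⟩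
  have := hZ'.isProbabilityMeasure_iff.mp inferInstance
  have := hX.isProbabilityMeasure_iff.mp inferInstance
  have hpair := hZX.hasLaw_prod hZ' hX
  have hms : MeasurableSet {z : ℝ × ℝ | z.1 + w * z.2 < r} :=
    measurableSet_lt (by fun_prop) (by fun_prop)
  have hcdf : ∀ y, (μ.map Z) ((fun z => (z, y)) ⁻¹' {z : ℝ × ℝ | z.1 + w * z.2 < r}) =
      ENNReal.ofReal (μ.real {ω | Z ω < r - w * y}) := fun y => by
    rw [ofReal_measureReal, Measure.map_apply_of_aemeasurable hZ (measurable_prodMk_right hms)]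
    congr 1
    ext ω
    simp [lt_sub_iff_add_lt]
  have hm1 := measurable_cdf_lt μ Z
  have hm2 : Measurable fun y => μ.real {ω | Z ω < r - w * y} :=
    hm1.comp (g := fun s => μ.real {ω | Z ω < s}) (f := fun y => r - w * y) (by fun_prop)
  rw [measureReal_def, hpair.measure_eq (p := fun z => z.1 + w * z.2 < r) hms,
    Measure.prod_apply_symm hms]
  simp_rw [hcdf]
  rw [lintegral_withDensity_eq_lintegral_mul _ hf.ennreal_ofReal hm2.ennreal_ofReal,
    integral_eq_lintegral_of_nonneg_ae (.of_forall fun y => mul_nonneg measureReal_nonneg (hf0 y))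
      (by fun_prop)]
  congr 1
  refine lintegral_congr fun y => ?_
  rw [Pi.mul_apply, mul_comm, ENNReal.ofReal_mul measureReal_nonneg]

lemma integral_betaPDFReal {a b : ℝ} (ha : 0 < a) (hb : 0 < b) : ∫ x, betaPDFReal a b x = 1 := by
  rw [integral_eq_lintegral_of_nonneg_ae (.of_forall fun x => ?_) (by fun_prop)]
  · exact (congrArg ENNReal.toReal (lintegral_betaPDF_eq_one ha hb)).trans ENNReal.toReal_one
  · by_cases hx : 0 < x ∧ x < 1
    · exact (betaPDFReal_pos hx.1 hx.2 ha hb).le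
    · simp [betaPDFReal, hx]

lemma tendsto_mul_const_nhdsGT_zero {u : ℝ} (hu : 0 < u) :
    Tendsto (fun r : ℝ => r * u) (𝓝[>] 0) (𝓝[>] 0) := by
  refine tendsto_nhdsWithin_iff.mpr ⟨?_, ?_⟩
  · have : Continuous fun x : ℝ => x * u := by fun_prop
    simpa using (this.tendsto 0).mono_left nhdsWithin_le_nhds
  · filter_upwards [self_mem_nhdsWithin] with x (hx : 0 < x)
    exact Set.mem_Ioi.mpr (by positivity)

/-- If `F` behaves like `A * s ^ a` and the density `f` like `c * x ^ (q - 1)` at the origin, then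
their convolution behaves like a multiple of `r ^ (a + q)`. -/
lemma IsPowerLawDensity.tendsto_convolution {f F : ℝ → ℝ} {q c A a w : ℝ}
    (hf : IsPowerLawDensity f q c) (ha : 0 ≤ a) (hw : 0 < w) (hFm : Measurable F)
    (hF0 : ∀ s, 0 ≤ F s) (hFz : ∀ s ≤ 0, F s = 0)
    (hF : Tendsto (fun s => F s / s ^ a) (𝓝[>] 0) (𝓝 A)) :
    Tendsto (fun r => (∫ y, F (r - w * y) * f y) / r ^ (a + q)) (𝓝[>] 0)
      (𝓝 (A * c * w⁻¹ ^ q * beta q (a + 1))) := by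
  have hq := hf.exponent_pos
  have hfm := hf.measurable
  obtain ⟨C, hC⟩ := hf.bound
  -- The normalised integrand after `y = r * w⁻¹ * u`, so that `r - w * y = r * (1 - u)`. The two
  -- quotients tend to `A` and `c`, leaving a Beta integrand. Outside `(0, 1)` either `f` or `F`
  -- vanishes.
  set D : ℝ → ℝ → ℝ := fun r u => if 0 < u ∧ u < 1 then
    F (r * (1 - u)) / (r * (1 - u)) ^ a * (f (r * (w⁻¹ * u)) / (r * (w⁻¹ * u)) ^ (q - 1)) *
      (w⁻¹ ^ q * (u ^ (q - 1) * (1 - u) ^ a)) else 0 with hD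
  have hDm : ∀ r, Measurable (D r) := fun r =>
    Measurable.ite measurableSet_Ioo (by fun_prop) measurable_const
  have hscale : ∀ r, 0 < r → ∫ u, D r u = (∫ y, F (r - w * y) * f y) / r ^ (a + q) := by
    intro r hr
    have hrw : 0 < r * w⁻¹ := by positivity
    have h1 := Measure.integral_comp_mul_left (fun y => F (r - w * y) * f y) (r * w⁻¹)
    rw [abs_of_pos (inv_pos.mpr hrw), smul_eq_mul] at h1
    have h2 : ∫ y, F (r - w * y) * f y =
        r * w⁻¹ * ∫ u, F (r - w * (r * w⁻¹ * u)) * f (r * w⁻¹ * u) := by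
      rw [h1, ← mul_assoc, mul_inv_cancel₀ hrw.ne', one_mul]
    rw [h2, ← integral_const_mul, ← integral_div]
    refine integral_congr_ae (.of_forall fun u => ?_)
    have e1 : r - w * (r * w⁻¹ * u) = r * (1 - u) := by
      field_simp
    simp only [hD, e1]
    split_ifs with hu
    · have h1u : 0 < 1 - u := by linarith [hu.2]
      have hu0 := hu.1
      have ew : w⁻¹ ^ q = w⁻¹ ^ (q - 1) * w⁻¹ := by
        rw [← Real.rpow_add_one (by positivity), sub_add_cancel]
      have er : r ^ (a + q) = r ^ a * (r ^ (q - 1) * r) := by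
        rw [← Real.rpow_add_one hr.ne', sub_add_cancel, ← Real.rpow_add hr]
      rw [er, ew, Real.mul_rpow hr.le h1u.le, Real.mul_rpow hr.le (by positivity),
        Real.mul_rpow (by positivity) hu0.le, ← mul_assoc r]
      have := Real.rpow_pos_of_pos hr a
      have := Real.rpow_pos_of_pos hr (q - 1)
      have := Real.rpow_pos_of_pos hu0 (q - 1)
      have := Real.rpow_pos_of_pos h1u a
      have := Real.rpow_pos_of_pos (inv_pos.mpr hw) (q - 1)
      generalize w⁻¹ ^ (q - 1) = W at *
      field_simp
    · rcases not_and_or.mp hu with h | h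
      · rw [hf.eq_zero (r * w⁻¹ * u) (mul_nonpos_of_nonneg_of_nonpos hrw.le (not_lt.mp h))]
        simp
      · rw [hFz (r * (1 - u)) (mul_nonpos_of_nonneg_of_nonpos hr.le (by linarith))]
        simp
  -- The limit is written as an integral of the Beta density, the form in which dominated
  -- convergence delivers it.
  have hlim : A * c * w⁻¹ ^ q * beta q (a + 1) =
      ∫ u, A * c * w⁻¹ ^ q * beta q (a + 1) * betaPDFReal q (a + 1) u := by
    rw [integral_const_mul, integral_betaPDFReal hq (by linarith), mul_one]
  rw [hlim]
  refine Tendsto.congr' (f₁ := fun r => ∫ u, D r u) ?_ ?_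
  · filter_upwards [self_mem_nhdsWithin] with r hr using hscale r hr
  -- `F s / s ^ a` is controlled only near 0; for `r < δ` every argument `r * (1 - u)` lies in that
  -- range.
  obtain ⟨δ, hδ, hFδ⟩ : ∃ δ > 0, ∀ s, 0 < s → s < δ → F s / s ^ a ≤ A + 1 := by
    have := hF.eventually_le_const (lt_add_one A)
    obtain ⟨δ, hδ, h⟩ := mem_nhdsGT_iff_exists_Ioo_subset.mp this
    exact ⟨δ, hδ, fun s hs hs' => h ⟨hs, hs'⟩⟩
  have hA0 : 0 ≤ A := ge_of_tendsto hF (by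
    filter_upwards [self_mem_nhdsWithin] with s (hs : 0 < s)
    have := hF0 s
    positivity)
  have hΨ : ∀ x, 0 < x → f x / x ^ (q - 1) ≤ C := fun x hx =>
    (div_le_iff₀ (Real.rpow_pos_of_pos hx _)).mpr (hC x hx)
  have hΨ0 : ∀ x, 0 < x → 0 ≤ f x / x ^ (q - 1) := fun x hx => by
    have := hf.nonneg x
    positivity
  have hC0 : 0 ≤ C := (hΨ0 1 one_pos).trans (hΨ 1 one_pos)
  -- The bound drops `(1 - u) ^ a ≤ 1`, valid as `0 ≤ a`; what remains is integrable because `0 <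
  -- q`.
  refine tendsto_integral_filter_of_dominated_convergence
    ((Set.Ioo 0 1).indicator fun u => (A + 1) * C * w⁻¹ ^ q * u ^ (q - 1))
    (.of_forall fun r => (hDm r).aestronglyMeasurable) ?_ ?_ ?_
  · filter_upwards [Ioo_mem_nhdsGT hδ] with r hr
    refine .of_forall fun u => ?_
    by_cases hu : 0 < u ∧ u < 1
    · have h1u : 0 < 1 - u := by linarith [hu.2]
      have hu0 := hu.1
      have hr0 := hr.1
      rw [Set.indicator_of_mem (show u ∈ Set.Ioo 0 1 from hu)]
      simp only [hD, if_pos hu]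
      have b1 := hFδ (r * (1 - u)) (by positivity) (by nlinarith [hr.2])
      have b2 := hΨ (r * (w⁻¹ * u)) (by positivity)
      have b3 := hΨ0 (r * (w⁻¹ * u)) (by positivity)
      have b4 : (1 - u) ^ a ≤ 1 := Real.rpow_le_one h1u.le (by linarith) ha
      have b5 := hF0 (r * (1 - u))
      have b6 : 0 ≤ F (r * (1 - u)) / (r * (1 - u)) ^ a := by positivity
      have b7 : u ^ (q - 1) * (1 - u) ^ a ≤ u ^ (q - 1) :=
        mul_le_of_le_one_right (by positivity) b4
      rw [Real.norm_of_nonneg (by positivity), mul_assoc _ _ (u ^ (q - 1))]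
      gcongr
    · rw [Set.indicator_of_notMem (show u ∉ Set.Ioo 0 1 from hu)]
      simp [hD, hu]
  · rw [integrable_indicator_iff measurableSet_Ioo]
    exact ((intervalIntegral.integrableOn_Ioo_rpow_iff one_pos).mpr (by linarith)).const_mul _
  · refine .of_forall fun u => ?_
    by_cases hu : 0 < u ∧ u < 1
    · have h1u : 0 < 1 - u := by linarith [hu.2]
      have hu0 := hu.1
      simp only [hD, if_pos hu, betaPDFReal]
      have t1 := hF.comp (tendsto_mul_const_nhdsGT_zero h1u)
      have t2 := hf.tendsto.comp
        (tendsto_mul_const_nhdsGT_zero (show 0 < w⁻¹ * u by positivity))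
      convert (t1.mul t2).mul_const (w⁻¹ ^ q * (u ^ (q - 1) * (1 - u) ^ a)) using 1
      congr 1
      rw [add_sub_cancel_right]
      have := beta_pos hq (show 0 < a + 1 by linarith)
      field_simp
    · simp [hD, hu, betaPDFReal]

/-- Makes the induction telescope: each new summand contributes `Γ(q)` and moves its exponent into
the Gamma function of the denominator. -/
lemma beta_div_Gamma {a q : ℝ} (ha : 0 ≤ a) :
    beta q (a + 1) / Real.Gamma (1 + a) = Real.Gamma q / Real.Gamma (1 + (q + a)) := by
  have := (Real.Gamma_pos_of_pos (show 0 < 1 + a by linarith)).ne'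
  rw [beta, add_comm a 1, show q + (1 + a) = 1 + (q + a) by ring]
  field_simp

lemma IsPowerLawDensity.ae_pos {f : ℝ → ℝ} {q c : ℝ} (hf : IsPowerLawDensity f q c) {Ω : Type*}
    [MeasurableSpace Ω] {μ : Measure Ω} {X : Ω → ℝ}
    (hX : HasLaw X (volume.withDensity fun x => ENNReal.ofReal (f x)) μ) :
    ∀ᵐ ω ∂μ, 0 < X ω := by
  rw [hX.ae_iff (measurableSet_setOfPred.mp measurableSet_Ioi),
    ae_withDensity_iff hf.measurable.ennreal_ofReal]
  refine .of_forall fun x hx => ?_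
  by_contra h
  exact hx (by rw [hf.eq_zero x (not_lt.mp h), ENNReal.ofReal_zero])

section Sums

variable {Ω : Type*} [MeasurableSpace Ω] {μ : Measure Ω} [IsProbabilityMeasure μ]

/-- The lower tail of a sum of independent variables with power law densities. -/
lemma tendsto_measureReal_sum_lt {ι : Type*} {f : ι → ℝ → ℝ} {q c w : ι → ℝ}
    (hf : ∀ i, IsPowerLawDensity (f i) (q i) (c i)) (hw : ∀ i, 0 < w i) {X : ι → Ω → ℝ}
    (hX : ∀ i, HasLaw (X i) (volume.withDensity fun x => ENNReal.ofReal (f i x)) μ)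
    (hindep : iIndepFun X μ) (S : Finset ι) :
    Tendsto (fun r => μ.real {ω | ∑ i ∈ S, w i * X i ω < r} / r ^ (∑ i ∈ S, q i)) (𝓝[>] 0)
      (𝓝 ((∏ i ∈ S, c i * (w i)⁻¹ ^ q i * Real.Gamma (q i)) /
        Real.Gamma (1 + ∑ i ∈ S, q i))) := by
  classical
  induction S using Finset.induction_on with
  | empty =>
    -- The empty sum is 0, so for `r > 0` the quotient is `1 / r ^ 0 = 1`, matching `1 / Γ(1)`.
    refine tendsto_const_nhds.congr' ?_
    filter_upwards [self_mem_nhdsWithin] with r (hr : 0 < r)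
    simp [hr]
  | insert j S hj ih =>
    have hsum : 0 ≤ ∑ i ∈ S, q i := Finset.sum_nonneg fun i _ => (hf i).exponent_pos.le
    have hpos : ∀ᵐ ω ∂μ, 0 ≤ ∑ i ∈ S, w i * X i ω := by
      filter_upwards [(ae_ball_iff S.countable_toSet (p := fun ω i _ => 0 < X i ω)).mpr
        fun i _ => (hf i).ae_pos (hX i)] with ω hω
      exact Finset.sum_nonneg fun i hi => mul_nonneg (hw i).le (hω i hi).le
    have hXm : ∀ i, AEMeasurable (X i) μ := fun i => (hX i).aemeasurable
    have hZm : AEMeasurable (fun ω => ∑ i ∈ S, w i * X i ω) μ := by fun_prop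
    have hind : IndepFun (fun ω => ∑ i ∈ S, w i * X i ω) (X j) μ := by
      have h := hindep.indepFun_finset₀ S {j} (by simpa using hj) hXm
      have hm : Measurable fun x : ({j} : Finset ι) → ℝ => x ⟨j, Finset.mem_singleton_self j⟩ :=
        measurable_pi_apply _
      have h' := h.comp (φ := fun x : S → ℝ => ∑ i : S, w i * x i) (by fun_prop) hm
      have hsum_eq : (fun ω => ∑ i ∈ S, w i * X i ω) = fun ω => ∑ i : S, w i * X i ω :=
        funext fun ω => (Finset.sum_coe_sort S fun i => w i * X i ω).symm
      rw [hsum_eq]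
      exact h'
    have key := (hf j).tendsto_convolution hsum (hw j)
      (measurable_cdf_lt μ fun ω => ∑ i ∈ S, w i * X i ω) (fun s => measureReal_nonneg)
      (fun s hs => by
        rw [measureReal_def, ENNReal.toReal_eq_zero_iff]
        refine .inl ?_
        rw [← compl_compl {ω | ∑ i ∈ S, w i * X i ω < s}, ← mem_ae_iff]
        filter_upwards [hpos] with ω hω
        simpa using hs.trans hω) ih
    have hval : (∏ i ∈ insert j S, c i * (w i)⁻¹ ^ q i * Real.Gamma (q i)) /
          Real.Gamma (1 + ∑ i ∈ insert j S, q i) =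
        (∏ i ∈ S, c i * (w i)⁻¹ ^ q i * Real.Gamma (q i)) / Real.Gamma (1 + ∑ i ∈ S, q i) *
          c j * (w j)⁻¹ ^ q j * beta (q j) (∑ i ∈ S, q i + 1) := by
      rw [Finset.prod_insert hj, Finset.sum_insert hj]
      linear_combination (-(c j * (w j)⁻¹ ^ q j * ∏ i ∈ S, c i * (w i)⁻¹ ^ q i *
        Real.Gamma (q i))) * beta_div_Gamma (q := q j) hsum
    rw [hval]
    refine key.congr fun r => ?_
    rw [← measureReal_add_mul_lt (hf j).measurable (hf j).nonneg hZm (hX j) hind,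
      Finset.sum_insert hj, add_comm (q j)]
    simp_rw [Finset.sum_insert hj, add_comm (w j * _)]

end Sums

/-! ### Auxiliary facts, and tails of absolute values. -/

lemma ae_mul_ne_of_hasLaw_withDensity {f : ℝ → ENNReal} {Ω : Type*} [MeasurableSpace Ω]
    {μ : Measure Ω} {X : Ω → ℝ} (hX : HasLaw X (volume.withDensity f) μ) {w : ℝ} (hw : 0 < w)
    (r : ℝ) : ∀ᵐ ω ∂μ, w * X ω ≠ r := by
  have h : ∀ᵐ ω ∂μ, X ω ≠ r / w := by
    rw [hX.ae_iff (p := fun x => x ≠ r / w)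
      (measurableSet_setOfPred.mp (measurableSet_singleton _).compl)]
    exact (withDensity_absolutelyContinuous _ _).ae_le (Measure.ae_ne volume _)
  filter_upwards [h] with ω hω h
  exact hω ((eq_div_iff hw.ne').mpr (by rw [mul_comm, h]))

/-- Nonnegativity of the `v i` rules out cancellation between leading terms. -/
lemma Asymptotics.IsEquivalent.finsetSum_of_nonneg {ι κ : Type*} {l : Filter κ} {s : Finset ι}
    {u v : ι → κ → ℝ} (hv : ∀ i ∈ s, 0 ≤ v i) (h : ∀ i ∈ s, u i ~[l] v i) :
    (∑ i ∈ s, u i) ~[l] ∑ i ∈ s, v i := by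
  classical
  induction s using Finset.induction_on with
  | empty => exact IsEquivalent.refl
  | insert j s hj ih =>
    rw [Finset.sum_insert hj, Finset.sum_insert hj]
    exact IsEquivalent.add_add_of_nonneg (hv j (Finset.mem_insert_self j s))
      (Finset.sum_nonneg fun i hi => hv i (Finset.mem_insert_of_mem hi))
      (h j (Finset.mem_insert_self j s))
      (ih (fun i hi => hv i (Finset.mem_insert_of_mem hi))
        fun i hi => h i (Finset.mem_insert_of_mem hi))

lemma ProbabilityTheory.iIndepFun.indepFun_sumElim {Ω ι : Type*} [MeasurableSpace Ω]
    {μ : Measure Ω} [Fintype ι] {X Y : ι → Ω → ℝ}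
    (hX : ∀ i, AEMeasurable (X i) μ) (hY : ∀ i, AEMeasurable (Y i) μ)
    (hindep : iIndepFun (fun i : ι ⊕ ι => Sum.elim X Y i) μ) :
    IndepFun (fun ω i => X i ω) (fun ω i => Y i ω) μ := by
  classical
  have h := hindep.indepFun_finset₀ (Finset.univ.map Function.Embedding.inl)
    (Finset.univ.map Function.Embedding.inr)
    (by simp [Finset.disjoint_left]) (fun i => by cases i <;> simp [hX, hY])
  have hl : ∀ i, Sum.inl i ∈ (Finset.univ.map Function.Embedding.inl : Finset (ι ⊕ ι)) := by simp
  have hr : ∀ i, Sum.inr i ∈ (Finset.univ.map Function.Embedding.inr : Finset (ι ⊕ ι)) := by simp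
  have m1 : Measurable fun (x : ↥(Finset.univ.map Function.Embedding.inl : Finset (ι ⊕ ι)) → ℝ)
      (i : ι) => x ⟨Sum.inl i, hl i⟩ := measurable_pi_lambda _ fun i => measurable_pi_apply _
  have m2 : Measurable fun (x : ↥(Finset.univ.map Function.Embedding.inr : Finset (ι ⊕ ι)) → ℝ)
      (i : ι) => x ⟨Sum.inr i, hr i⟩ := measurable_pi_lambda _ fun i => measurable_pi_apply _
  exact h.comp m1 m2

section Sums

variable {Ω : Type*} [MeasurableSpace Ω] {μ : Measure Ω} [IsProbabilityMeasure μ]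

/-- The SNR sees only `|g|`; almost surely the sums are nonnegative, so the absolute value changes
nothing. -/
lemma tendsto_measureReal_abs_sum_lt {ι : Type*} {f : ι → ℝ → ℝ} {q c w : ι → ℝ}
    (hf : ∀ i, IsPowerLawDensity (f i) (q i) (c i)) (hw : ∀ i, 0 < w i) {X : ι → Ω → ℝ}
    (hX : ∀ i, HasLaw (X i) (volume.withDensity fun x => ENNReal.ofReal (f i x)) μ)
    (hindep : iIndepFun X μ) (S : Finset ι) :
    Tendsto (fun r => μ.real {ω | |∑ i ∈ S, w i * X i ω| < r} / r ^ (∑ i ∈ S, q i)) (𝓝[>] 0)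
      (𝓝 ((∏ i ∈ S, c i * (w i)⁻¹ ^ q i * Real.Gamma (q i)) /
        Real.Gamma (1 + ∑ i ∈ S, q i))) := by
  refine (tendsto_measureReal_sum_lt hf hw hX hindep S).congr fun r => ?_
  congr 1
  refine measureReal_congr ?_
  filter_upwards [(ae_ball_iff S.countable_toSet (p := fun ω i _ => 0 < X i ω)).mpr
    fun i _ => (hf i).ae_pos (hX i)] with ω hω
  have : 0 ≤ ∑ i ∈ S, w i * X i ω :=
    Finset.sum_nonneg fun i hi => mul_nonneg (hw i).le (hω i hi).le
  change (_ < r) = (|_| < r)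
  rw [abs_of_nonneg this]

/-- The one-term case of the sum asymptotics, with `Γ(q) / Γ(1 + q) = 1 / q`. A law with a density
has no atoms, so `≤` may replace `<`. -/
lemma IsPowerLawDensity.tendsto_measureReal_abs_le {f : ℝ → ℝ} {q c w : ℝ}
    (hf : IsPowerLawDensity f q c) (hw : 0 < w) {X : Ω → ℝ}
    (hX : HasLaw X (volume.withDensity fun x => ENNReal.ofReal (f x)) μ) :
    Tendsto (fun r => μ.real {ω | ¬ r < |w * X ω|} / r ^ q) (𝓝[>] 0) (𝓝 (c * w⁻¹ ^ q / q)) := by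
  have hq := hf.exponent_pos
  have h := tendsto_measureReal_abs_sum_lt (ι := Unit) (fun _ => hf) (fun _ => hw) (fun _ => hX)
    iIndepFun.of_subsingleton Finset.univ
  have hΓ := Real.Gamma_pos_of_pos hq
  have hval : c * w⁻¹ ^ q * Real.Gamma q / Real.Gamma (1 + q) = c * w⁻¹ ^ q / q := by
    rw [add_comm, Real.Gamma_add_one hq.ne']
    field_simp
  simp only [Finset.univ_unique, Finset.sum_singleton, Finset.prod_singleton, hval] at h
  refine h.congr fun r => ?_
  congr 1
  refine measureReal_congr ?_
  filter_upwards [hf.ae_pos hX, ae_mul_ne_of_hasLaw_withDensity hX hw r] with ω hω hne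
  change (|_| < r) = ¬ (r < |_|)
  rw [abs_of_nonneg (by positivity), not_lt, lt_iff_le_and_ne]
  simp [hne]

lemma IsPowerLawDensity.tendsto_measureReal_lt_abs {f : ℝ → ℝ} {q c w : ℝ}
    (hf : IsPowerLawDensity f q c) (hw : 0 < w) {X : Ω → ℝ}
    (hX : HasLaw X (volume.withDensity fun x => ENNReal.ofReal (f x)) μ) :
    Tendsto (fun r => μ.real {ω | r < |w * X ω|}) (𝓝[>] 0) (𝓝 1) := by
  have hXm := hX.aemeasurable
  have hq := hf.exponent_pos
  have h0 : Tendsto (fun r : ℝ => r ^ q) (𝓝[>] 0) (𝓝 0) := by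
    have := (Real.continuous_rpow_const hq.le).tendsto 0
    rw [Real.zero_rpow hq.ne'] at this
    exact this.mono_left nhdsWithin_le_nhds
  have h := ((hf.tendsto_measureReal_abs_le hw hX).mul h0).const_sub 1
  rw [mul_zero, sub_zero] at h
  refine h.congr' ?_
  filter_upwards [self_mem_nhdsWithin] with r (hr : 0 < r)
  have hms : NullMeasurableSet {ω | r < |w * X ω|} μ :=
    nullMeasurableSet_lt aemeasurable_const (by fun_prop)
  have hc := probReal_compl_eq_one_sub₀ hms
  rw [div_mul_cancel₀ _ (by positivity)]
  change 1 - μ.real {ω | r < |w * X ω|}ᶜ = _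
  rw [hc]
  ring

end Sums

/-! ### Factorisation of the exceedance event. -/

section Exceedance

variable {Ω : Type*} [MeasurableSpace Ω] {μ : Measure Ω}

/-- Exactly the coordinates in `S` of one family exceed `r`, and the weighted sum of a second
family over `S` is below `r`. -/
def exceedanceEvent {ι : Type*} (v w : ι → ℝ) (X Y : ι → Ω → ℝ) (S : Finset ι) (r : ℝ) : Set Ω :=
  {ω | (∀ i, r < |v i * X i ω| ↔ i ∈ S) ∧ |∑ i ∈ S, w i * Y i ω| < r}

lemma nullMeasurableSet_exceedanceEvent {ι : Type*} [Finite ι] (v w : ι → ℝ) {X Y : ι → Ω → ℝ}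
    (hX : ∀ i, AEMeasurable (X i) μ) (hY : ∀ i, AEMeasurable (Y i) μ) (S : Finset ι) (r : ℝ) :
    NullMeasurableSet (exceedanceEvent v w X Y S r) μ := by
  refine NullMeasurableSet.inter (s := {ω | ∀ i, r < |v i * X i ω| ↔ i ∈ S})
    (t := {ω | |∑ i ∈ S, w i * Y i ω| < r}) ?_
    (nullMeasurableSet_lt (by fun_prop) aemeasurable_const)
  have hset : {ω | ∀ i, r < |v i * X i ω| ↔ i ∈ S} = ⋂ i, {ω | r < |v i * X i ω| ↔ i ∈ S} := by
    ext ω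
    simp
  rw [hset]
  refine NullMeasurableSet.iInter fun i => ?_
  have h : NullMeasurableSet {ω | r < |v i * X i ω|} μ :=
    nullMeasurableSet_lt aemeasurable_const (by fun_prop)
  by_cases hi : i ∈ S
  · simpa only [hi, iff_true] using h
  · simp only [hi, iff_false]
    exact h.compl

/-- Independence enters twice: between the blocks `X` and `Y`, then among the coordinates of `X`.
The sum over `Y` stays a single factor. -/
lemma measureReal_exceedanceEvent {ι : Type*} [Fintype ι] [DecidableEq ι] (v w : ι → ℝ)
    {X Y : ι → Ω → ℝ} (hX : ∀ i, AEMeasurable (X i) μ) (hY : ∀ i, AEMeasurable (Y i) μ)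
    (hindep : iIndepFun (fun i : ι ⊕ ι => Sum.elim X Y i) μ) (S : Finset ι) (r : ℝ) :
    μ.real (exceedanceEvent v w X Y S r) =
      ((∏ i ∈ S, μ.real {ω | r < |v i * X i ω|}) *
        ∏ i ∈ Sᶜ, μ.real {ω | ¬ r < |v i * X i ω|}) *
        μ.real {ω | |∑ i ∈ S, w i * Y i ω| < r} := by
  have hlt : ∀ i, MeasurableSet {x : ℝ | r < |v i * x|} := fun i =>
    measurableSet_lt (by fun_prop) (by fun_prop)
  have hA : ∀ i, MeasurableSet {x : ℝ | r < |v i * x| ↔ i ∈ S} := fun i => by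
    by_cases hi : i ∈ S
    · simpa only [hi, iff_true] using hlt i
    · simp only [hi, iff_false]
      exact (hlt i).compl
  have hB : MeasurableSet {y : ι → ℝ | |∑ i ∈ S, w i * y i| < r} :=
    measurableSet_lt (by fun_prop) (by fun_prop)
  have hprod : MeasurableSet (⋂ i, (fun x : ι → ℝ => x i) ⁻¹' {x : ℝ | r < |v i * x| ↔ i ∈ S}) :=
    MeasurableSet.iInter fun i => measurable_pi_apply i (hA i)
  have h1 := (hindep.indepFun_sumElim hX hY).measure_inter_preimage_eq_mul _ _ hprod hB
  have hXi : iIndepFun X μ := hindep.precomp (g := Sum.inl) Sum.inl_injective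
  have h2 := hXi.measure_inter_preimage_eq_mul Finset.univ
    (sets := fun i => {x : ℝ | r < |v i * x| ↔ i ∈ S}) fun i _ => hA i
  have hset : exceedanceEvent v w X Y S r =
      (fun ω i => X i ω) ⁻¹' (⋂ i, (fun x : ι → ℝ => x i) ⁻¹' {x : ℝ | r < |v i * x| ↔ i ∈ S}) ∩
        (fun ω i => Y i ω) ⁻¹' {y : ι → ℝ | |∑ i ∈ S, w i * y i| < r} := by
    ext ω
    simp [exceedanceEvent]
  have hset2 : (fun ω i => X i ω) ⁻¹'
        (⋂ i, (fun x : ι → ℝ => x i) ⁻¹' {x : ℝ | r < |v i * x| ↔ i ∈ S}) =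
      ⋂ i ∈ Finset.univ, X i ⁻¹' {x : ℝ | r < |v i * x| ↔ i ∈ S} := by
    ext ω
    simp
  rw [measureReal_def, hset, h1, hset2, h2, ENNReal.toReal_mul, ENNReal.toReal_prod,
    ← Finset.prod_mul_prod_compl S]
  congr 2
  · refine Finset.prod_congr rfl fun i hi => ?_
    rw [measureReal_def]
    congr 2
    ext ω
    simp [hi]
  · refine Finset.prod_congr rfl fun i hi => ?_
    rw [measureReal_def]
    congr 2
    ext ω
    simp [Finset.mem_compl.mp hi]

end Exceedance

/-! ### From the relay protocol to exceedance events. -/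

namespace FSO

/-- The product `ρ * hbar` of the deterministic factors of the weighted gain. -/
noncomputable def Link.weight (L : Link) : ℝ := L.ρ * L.hbar

lemma Link.weight_pos (L : Link) : 0 < L.weight := mul_pos L.ρ_pos L.hbar_pos

lemma Link.weightedGain_eq (L : Link) (x : ℝ) : L.weightedGain x = L.weight * x :=
  (mul_assoc _ _ _).symm

lemma Link.leadingCoeff_mul (L : Link) :
    L.leadingCoeff * L.weight⁻¹ ^ L.q = (L.α * L.β / (L.hbar * L.ρ)) ^ L.q *
      (Real.Gamma (L.p - L.q) / (Real.Gamma L.α * Real.Gamma L.β)) := by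
  have := L.α_pos
  have := L.β_pos
  have := L.weight_pos
  rw [div_eq_mul_inv (L.α * L.β), mul_comm L.hbar, ← Link.weight,
    Real.mul_rpow (by positivity) (by positivity), Link.leadingCoeff]
  ring

namespace OperatingPoint

variable (o : OperatingPoint)

lemma powerMargin_pos : 0 < o.powerMargin := by
  have := o.η_pos
  have := o.Tb_pos
  have := o.Pt_pos
  have := o.N0_pos
  have := o.γth_pos
  rw [powerMargin]
  positivity

/-- Relative to the threshold, the SNR depends on the operating point only through `powerMargin`;
hence the parameters may vary along an arbitrary filter. -/
lemma snr_eq (g : ℝ) : o.snr g = (o.powerMargin * |g|) ^ 2 * o.γth := by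
  have := o.N0_pos
  have := o.γth_pos
  rw [snr, powerMargin, mul_pow, div_pow, Real.sq_sqrt (by positivity), sq_abs]
  field_simp

lemma γth_lt_snr_iff (g : ℝ) : o.γth < o.snr g ↔ o.powerMargin⁻¹ < |g| := by
  have := o.powerMargin_pos
  rw [snr_eq, lt_mul_iff_one_lt_left o.γth_pos, one_lt_sq_iff₀ (by positivity),
    inv_lt_iff_one_lt_mul₀' this]

lemma snr_lt_γth_iff (g : ℝ) : o.snr g < o.γth ↔ |g| < o.powerMargin⁻¹ := by
  have := o.powerMargin_pos
  rw [snr_eq, mul_lt_iff_lt_one_left o.γth_pos, sq_lt_one_iff₀ (by positivity),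
    ← one_div, lt_div_iff₀' this]

end OperatingPoint

variable {N : ℕ} (SR RD : Fin N → Link)

/-- The factor of `(1 / PM) ^ (∑ q)` in `asympTerm`. -/
noncomputable def asympCoeff (S : Finset (Fin N)) : ℝ :=
  (∏ m ∈ Sᶜ, (SR m).leadingCoeff * (SR m).weight⁻¹ ^ (SR m).q / (SR m).q) *
    ((∏ m ∈ S, (RD m).leadingCoeff * (RD m).weight⁻¹ ^ (RD m).q * Real.Gamma (RD m).q) /
      Real.Gamma (1 + ∑ m ∈ S, (RD m).q))

lemma asympTerm_eq (S : Finset (Fin N)) (PM : ℝ) :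
    asympTerm SR RD S PM = asympCoeff SR RD S *
      PM⁻¹ ^ ((∑ m ∈ Sᶜ, (SR m).q) + ∑ m ∈ S, (RD m).q) := by
  simp only [asympTerm, asympCoeff, one_div, Link.leadingCoeff_mul]
  congr 3
  · funext m
    ring
  · refine Finset.prod_congr rfl fun m _ => ?_
    ring

variable {SR RD}

/-- A nonzero limit is what turns convergence of a quotient into an equivalence; the sign is needed
for adding the equivalences. -/
lemma asympCoeff_pos (hSR : ∀ m, (SR m).α ≠ (SR m).β) (hRD : ∀ m, (RD m).α ≠ (RD m).β)
    (S : Finset (Fin N)) : 0 < asympCoeff SR RD S := by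
  refine mul_pos (Finset.prod_pos fun m _ => ?_) (div_pos (Finset.prod_pos fun m _ => ?_) ?_)
  · have := Link.leadingCoeff_pos (hSR m)
    have := (SR m).weight_pos
    have := (SR m).q_pos
    positivity
  · have := Link.leadingCoeff_pos (hRD m)
    have := (RD m).weight_pos
    have := Real.Gamma_pos_of_pos (RD m).q_pos
    positivity
  · have : 0 ≤ ∑ m ∈ S, (RD m).q := Finset.sum_nonneg fun m _ => (RD m).q_pos.le
    exact Real.Gamma_pos_of_pos (by linarith)

lemma mem_decodingSet {o : OperatingPoint} {x : Fin N → ℝ} {m : Fin N} :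
    m ∈ decodingSet SR o x ↔ o.powerMargin⁻¹ < |(SR m).weight * x m| := by
  simp [decodingSet, OperatingPoint.γth_lt_snr_iff, Link.weightedGain_eq]

/-- An empty decoding set gives the sum 0, which is below `1 / P_M`, so the first alternative is
contained in the second. -/
lemma allActiveOutage_iff {o : OperatingPoint} {x y : Fin N → ℝ} :
    AllActiveOutage SR RD o x y ↔
      |∑ m ∈ decodingSet SR o x, (RD m).weight * y m| < o.powerMargin⁻¹ := by
  have h := inv_pos.mpr o.powerMargin_pos
  simp only [AllActiveOutage, OperatingPoint.snr_lt_γth_iff, Link.weightedGain_eq,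
    or_iff_right_iff_imp]
  intro h0
  simpa [h0] using h

variable {Ω : Type*}

lemma setOf_decodingSet_eq_and_outage (o : OperatingPoint) (X Y : Fin N → Ω → ℝ)
    (S : Finset (Fin N)) :
    {ω | decodingSet SR o (fun m => X m ω) = S ∧
        AllActiveOutage SR RD o (fun m => X m ω) (fun m => Y m ω)} =
      exceedanceEvent (fun m => (SR m).weight) (fun m => (RD m).weight) X Y S
        o.powerMargin⁻¹ := by
  ext ω
  have hS : decodingSet SR o (fun m => X m ω) = S ↔
      ∀ m, o.powerMargin⁻¹ < |(SR m).weight * X m ω| ↔ m ∈ S := by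
    simp [Finset.ext_iff, mem_decodingSet]
  change (_ ∧ _) ↔ (_ ∧ _)
  rw [← hS, and_congr_right_iff]
  rintro rfl
  exact allActiveOutage_iff

variable [MeasurableSpace Ω] {μ : Measure Ω} [IsProbabilityMeasure μ] {X Y : Fin N → Ω → ℝ}

lemma tendsto_measureReal_exceedanceEvent (hSR : ∀ m, (SR m).α ≠ (SR m).β)
    (hRD : ∀ m, (RD m).α ≠ (RD m).β)
    (hX : ∀ m, HasLaw (X m) (gammaGammaMeasure (SR m).α (SR m).β) μ)
    (hY : ∀ m, HasLaw (Y m) (gammaGammaMeasure (RD m).α (RD m).β) μ)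
    (hindep : iIndepFun (fun i : Fin N ⊕ Fin N => Sum.elim X Y i) μ) (S : Finset (Fin N)) :
    Tendsto (fun r => μ.real (exceedanceEvent (fun m => (SR m).weight) (fun m => (RD m).weight)
        X Y S r) / r ^ ((∑ m ∈ Sᶜ, (SR m).q) + ∑ m ∈ S, (RD m).q))
      (𝓝[>] 0) (𝓝 (asympCoeff SR RD S)) := by
  have h1 := tendsto_finsetProd S fun m (_ : m ∈ S) =>
    (Link.isPowerLawDensity (hSR m)).tendsto_measureReal_lt_abs (SR m).weight_pos (hX m)
  have h2 := tendsto_finsetProd Sᶜ fun m (_ : m ∈ Sᶜ) =>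
    (Link.isPowerLawDensity (hSR m)).tendsto_measureReal_abs_le (SR m).weight_pos (hX m)
  have hYi : iIndepFun Y μ := hindep.precomp (g := Sum.inr) Sum.inr_injective
  have h3 := tendsto_measureReal_abs_sum_lt (fun m => Link.isPowerLawDensity (hRD m))
    (fun m => (RD m).weight_pos) hY hYi S
  have h := (h1.mul h2).mul h3
  rw [Finset.prod_const_one, one_mul] at h
  refine h.congr' ?_
  filter_upwards [self_mem_nhdsWithin] with r (hr : 0 < r)
  rw [measureReal_exceedanceEvent _ _ (fun m => (hX m).aemeasurable)
    (fun m => (hY m).aemeasurable) hindep, Finset.prod_div_distrib, Real.rpow_add hr,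
    Real.rpow_sum_of_pos hr (fun m => (SR m).q) Sᶜ]
  ring

end FSO

/-! ### Assembly over all decoding sets. -/

theorem theorem3 {N : ℕ} (SR RD : Fin N → FSO.Link)
    (hSRint : ∀ (m : Fin N) (k : ℤ), (SR m).α - (SR m).β ≠ k)
    (hRDint : ∀ (m : Fin N) (k : ℤ), (RD m).α - (RD m).β ≠ k)
    {Ω : Type*} [MeasurableSpace Ω] (μ : Measure Ω) [IsProbabilityMeasure μ]
    (X Y : Fin N → Ω → ℝ)
    (hX : ∀ m, HasLaw (X m) (FSO.gammaGammaMeasure (SR m).α (SR m).β) μ)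
    (hY : ∀ m, HasLaw (Y m) (FSO.gammaGammaMeasure (RD m).α (RD m).β) μ)
    (hindep : iIndepFun (fun i : Fin N ⊕ Fin N => Sum.elim X Y i) μ)
    {κ : Type*} (l : Filter κ) (o : κ → FSO.OperatingPoint)
    (hPM : Tendsto (fun k => (o k).powerMargin) l atTop) :
    ((fun k => μ.real {ω | FSO.AllActiveOutage SR RD (o k) (fun m => X m ω) (fun m => Y m ω)})
        ~[l] fun k => ∑ S : Finset (Fin N), FSO.asympTerm SR RD S (o k).powerMargin) ∧
    ∀ S : Finset (Fin N),
      (fun k => μ.real {ω | FSO.decodingSet SR (o k) (fun m => X m ω) = S ∧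
          FSO.AllActiveOutage SR RD (o k) (fun m => X m ω) (fun m => Y m ω)})
        ~[l] fun k => FSO.asympTerm SR RD S (o k).powerMargin := by
  -- Excluding the integer 0 gives `q < p`, hence a positive argument in `Γ(p - q)`.
  have hSR : ∀ m, (SR m).α ≠ (SR m).β := fun m h => hSRint m 0 (by simp [h])
  have hRD : ∀ m, (RD m).α ≠ (RD m).β := fun m h => hRDint m 0 (by simp [h])
  have hr : Tendsto (fun k => (o k).powerMargin⁻¹) l (𝓝[>] 0) :=
    tendsto_inv_atTop_nhdsGT_zero.comp hPM
  have hterm : ∀ S : Finset (Fin N),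
      (fun k => μ.real {ω | FSO.decodingSet SR (o k) (fun m => X m ω) = S ∧
          FSO.AllActiveOutage SR RD (o k) (fun m => X m ω) (fun m => Y m ω)})
        ~[l] fun k => FSO.asympTerm SR RD S (o k).powerMargin := by
    intro S
    have h := (isEquivalent_const_iff_tendsto (FSO.asympCoeff_pos hSR hRD S).ne').mpr
      ((FSO.tendsto_measureReal_exceedanceEvent hSR hRD hX hY hindep S).comp hr)
    have h' := h.mul (IsEquivalent.refl (u := fun k =>
      (o k).powerMargin⁻¹ ^ ((∑ m ∈ Sᶜ, (SR m).q) + ∑ m ∈ S, (RD m).q)))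
    refine (h'.congr_left (.of_forall fun k => ?_)).congr_right (.of_forall fun k => ?_)
    · have := (o k).powerMargin_pos
      simp only [FSO.setOf_decodingSet_eq_and_outage, Pi.mul_apply, Function.comp_apply]
      rw [div_mul_cancel₀ _ (by positivity)]
    · simp only [FSO.asympTerm_eq, Pi.mul_apply, Function.const_apply]
  refine ⟨?_, hterm⟩
  have hsum := IsEquivalent.finsetSum_of_nonneg (s := Finset.univ)
    (fun S _ k => by
      have := (o k).powerMargin_pos
      have := FSO.asympCoeff_pos hSR hRD S
      rw [FSO.asympTerm_eq, Pi.zero_apply]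
      positivity) fun S _ => hterm S
  refine (hsum.congr_left (.of_forall fun k => ?_)).congr_right (.of_forall fun k => ?_)
  · have hunion : {ω | FSO.AllActiveOutage SR RD (o k) (fun m => X m ω) (fun m => Y m ω)} =
        ⋃ S ∈ (Finset.univ : Finset (Finset (Fin N))),
          {ω | FSO.decodingSet SR (o k) (fun m => X m ω) = S ∧
            FSO.AllActiveOutage SR RD (o k) (fun m => X m ω) (fun m => Y m ω)} := by
      ext ω
      simp
    rw [hunion, Finset.sum_apply, measureReal_biUnion_finset₀]
    · intro S _ T _ hST
      exact (Set.disjoint_left.mpr fun ω hS hT => hST (hS.1.symm.trans hT.1)).aedisjoint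
    · intro S _
      rw [FSO.setOf_decodingSet_eq_and_outage]
      exact nullMeasurableSet_exceedanceEvent _ _ (fun m => (hX m).aemeasurable)
        (fun m => (hY m).aemeasurable) S _
  · exact Finset.sum_apply k _ _
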